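/- Let $K^*/K$ be a finite field extension, let $\nu^*$ be a valuation of $K^*$ (of arbitrary rank, written additively, with values in an ordered abelian group), and let $\nu=\nu^*|_K$ be its restriction to $K$. For $\mu\in\{\nu,\nu^*\}$ let $\Gamma_\mu$ be the value group, $V_\mu=\{f\mid \mu(f)\ge 0\}$ the valuation ring with maximal ideal $m_\mu$, and $$ \mathrm{gr}_\mu(V_\mu)=\bigoplus_{\gamma\in\Gamma_\mu}\mathcal P_\gamma(V_\mu)/\mathcal P_\gamma^+(V_\mu),\qquad \mathcal P_\gamma(V_\mu)=\{f\in V_\mu\mid \mu(f)\ge\gamma\},\quad \mathcal P^+_\gamma(V_\mu)=\{f\in V_\mu\mid \mu(f)>\gamma\}, $$ the associated graded ring, with the multiplication induced by that of $V_\mu$. It is an integral domain, with quotient field $\mathrm{QF}(\mathrm{gr}_\mu(V_\mu))$. The inclusion $V_\nu\subset V_{\nu^*}$ induces an injective graded homomorphism $\mathrm{gr}_\nu(V_\nu)\to\mathrm{gr}_{\nu^*}(V_{\nu^*})$, through which $\mathrm{QF}(\mathrm{gr}_{\nu^*}(V_{\nu^*}))$ is an extension field of $\mathrm{QF}(\mathrm{gr}_\nu(V_\nu))$.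 Suppose that $V_\nu/m_\nu=V_{\nu^*}/m_{\nu^*}$ (that is, the natural inclusion of residue fields is an isomorphism) and that this field is algebraically closed of characteristic zero. Then $\mathrm{QF}(\mathrm{gr}_{\nu^*}(V_{\nu^*}))$ is a finite Galois extension of $\mathrm{QF}(\mathrm{gr}_\nu(V_\nu))$ whose Galois group is isomorphic to $\Gamma_{\nu^*}/\Gamma_\nu$. -/

import Mathlib

open scoped DirectSum

noncomputable section

namespace GrVal

section Single

variable {K Γ : Type*} [Field K] [AddCommGroup Γ] [LinearOrder Γ] [IsOrderedAddMonoid Γ]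

/-- The value group `Γ_ν = ν(K ∖ {0})` of a valuation `ν : K → Γ ∪ {∞}`, a subgroup of `Γ`. -/
def valueGroup (v : AddValuation K (WithTop Γ)) : AddSubgroup Γ where
  carrier := {γ | ∃ x : K, v x = (γ : WithTop Γ)}
  zero_mem' := ⟨1, by simp⟩
  add_mem' := by
    rintro a b ⟨x, hx⟩ ⟨y, hy⟩
    exact ⟨x * y, by rw [v.map_mul, hx, hy, WithTop.coe_add]⟩
  neg_mem' := by
    rintro a ⟨x, hx⟩
    exact ⟨x⁻¹, by rw [v.map_inv, hx]; rfl⟩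

/-- The valuation ring `V_ν = {f ∈ K | ν(f) ≥ 0}`. -/
def valRing (v : AddValuation K (WithTop Γ)) : ValuationSubring K where
  carrier := {f | 0 ≤ v f}
  zero_mem' := by simp
  one_mem' := by simp
  add_mem' := fun ha hb => v.map_le_add ha hb
  mul_mem' := by
    intro a b ha hb
    simp only [Set.mem_ofPred_eq] at ha hb ⊢
    rw [v.map_mul]
    exact add_nonneg ha hb
  neg_mem' := by
    intro a ha
    simpa only [Set.mem_ofPred_eq, v.map_neg] using ha
  mem_or_inv_mem' := by
    intro x
    by_cases hx : x = 0
    · left; simp [hx]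
    obtain ⟨γ, hγ⟩ := WithTop.ne_top_iff_exists.mp (v.ne_top_iff.mpr hx)
    rcases le_total 0 γ with h | h
    · left
      change 0 ≤ v x
      rw [← hγ]
      exact_mod_cast h
    · right
      change 0 ≤ v x⁻¹
      have : v x⁻¹ = ((-γ : Γ) : WithTop Γ) := by rw [v.map_inv, ← hγ]; rfl
      rw [this]
      exact_mod_cast neg_nonneg.mpr h

theorem mem_valRing (v : AddValuation K (WithTop Γ)) (x : K) : x ∈ valRing v ↔ 0 ≤ v x :=
  Iff.rfl

/-- The ideal `P_γ(V_ν) = {f ∈ V_ν | ν(f) ≥ γ}`. -/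
def P (v : AddValuation K (WithTop Γ)) (γ : valueGroup v) : Ideal (valRing v) where
  carrier := {f | ((γ : Γ) : WithTop Γ) ≤ v (f : K)}
  zero_mem' := by simp
  add_mem' := fun ha hb => v.map_le_add ha hb
  smul_mem' := by
    intro c x hx
    simp only [Set.mem_ofPred_eq] at hx ⊢
    change _ ≤ v ((c : K) * (x : K))
    rw [v.map_mul]
    exact hx.trans (le_add_of_nonneg_left c.2)

/-- The ideal `P_γ⁺(V_ν) = {f ∈ V_ν | ν(f) > γ}`. -/
def PPlus (v : AddValuation K (WithTop Γ)) (γ : valueGroup v) : Ideal (valRing v) where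
  carrier := {f | ((γ : Γ) : WithTop Γ) < v (f : K)}
  zero_mem' := by simp
  add_mem' := fun ha hb => v.map_lt_add ha hb
  smul_mem' := by
    intro c x hx
    simp only [Set.mem_ofPred_eq] at hx ⊢
    change _ < v ((c : K) * (x : K))
    rw [v.map_mul]
    exact hx.trans_le (le_add_of_nonneg_left c.2)

theorem mem_P (v : AddValuation K (WithTop Γ)) (γ : valueGroup v) (x : valRing v) :
    x ∈ P v γ ↔ ((γ : Γ) : WithTop Γ) ≤ v (x : K) := Iff.rfl

theorem mem_PPlus (v : AddValuation K (WithTop Γ)) (γ : valueGroup v) (x : valRing v) :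
    x ∈ PPlus v γ ↔ ((γ : Γ) : WithTop Γ) < v (x : K) := Iff.rfl

/-- The graded piece `P_γ(V_ν) / P_γ⁺(V_ν)`. -/
def Piece (v : AddValuation K (WithTop Γ)) (γ : valueGroup v) : Type _ :=
  ↥(P v γ) ⧸ (PPlus v γ).submoduleOf (P v γ)

instance instAddCommGroupPiece (v : AddValuation K (WithTop Γ)) (γ : valueGroup v) :
    AddCommGroup (Piece v γ) :=
  inferInstanceAs (AddCommGroup (↥(P v γ) ⧸ (PPlus v γ).submoduleOf (P v γ)))

/-- The class in `P_γ(V_ν) / P_γ⁺(V_ν)` of an element of `P_γ(V_ν)`. -/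
def cls (v : AddValuation K (WithTop Γ)) (γ : valueGroup v) (x : P v γ) : Piece v γ :=
  (Submodule.Quotient.mk x : ↥(P v γ) ⧸ (PPlus v γ).submoduleOf (P v γ))

variable {v : AddValuation K (WithTop Γ)}

theorem cls_surj {γ : valueGroup v} (a : Piece v γ) : ∃ x : P v γ, cls v γ x = a :=
  Submodule.Quotient.mk_surjective _ a

theorem cls_eq_iff {γ : valueGroup v} (x y : P v γ) :
    cls v γ x = cls v γ y ↔ ((γ : Γ) : WithTop Γ) < v ((x : valRing v) - (y : valRing v) : K) :=
  Submodule.Quotient.eq ((PPlus v γ).submoduleOf (P v γ))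

theorem cls_eq_zero_iff {γ : valueGroup v} (x : P v γ) :
    cls v γ x = 0 ↔ ((γ : Γ) : WithTop Γ) < v ((x : valRing v) : K) :=
  Submodule.Quotient.mk_eq_zero ((PPlus v γ).submoduleOf (P v γ))

theorem mul_mem_P {γ δ : valueGroup v} {x y : valRing v} (hx : x ∈ P v γ) (hy : y ∈ P v δ) :
    x * y ∈ P v (γ + δ) := by
  rw [mem_P] at *
  change _ ≤ v ((x : K) * (y : K))
  rw [v.map_mul]
  push_cast
  exact add_le_add hx hy

/-- The product `P_γ × P_δ → P_{γ+δ}` induced by multiplication in `V_ν`. -/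
def mulP {γ δ : valueGroup v} (x : P v γ) (y : P v δ) : P v (γ + δ) :=
  ⟨x.1 * y.1, mul_mem_P x.2 y.2⟩

theorem add_lt_of_le_of_lt {γ δ : Γ} {a b : WithTop Γ} (h₁ : (γ : WithTop Γ) ≤ a)
    (h₂ : (δ : WithTop Γ) < b) : ((γ + δ : Γ) : WithTop Γ) < a + b := by
  rw [WithTop.coe_add]
  exact WithTop.add_lt_add_of_le_of_lt WithTop.coe_ne_top h₁ h₂

theorem cls_mulP_congr {γ δ : valueGroup v} {x x' : P v γ} {y y' : P v δ}
    (hx : cls v γ x = cls v γ x') (hy : cls v δ y = cls v δ y') :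
    cls v (γ + δ) (mulP x y) = cls v (γ + δ) (mulP x' y') := by
  rw [cls_eq_iff] at *
  have e : (((mulP x y : P v (γ + δ)) : valRing v) : K) - ((mulP x' y' : P v (γ + δ)) : valRing v)
      = (x.1 : K) * ((y.1 : K) - (y'.1 : K)) + (y'.1 : K) * ((x.1 : K) - (x'.1 : K)) := by
    simp only [mulP]
    push_cast
    ring
  rw [e]
  apply v.map_lt_add
  · rw [v.map_mul]
    exact add_lt_of_le_of_lt x.2 hy
  · rw [v.map_mul, add_comm γ δ]
    exact add_lt_of_le_of_lt y'.2 hx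

/-- The product `P_γ/P_γ⁺ × P_δ/P_δ⁺ → P_{γ+δ}/P_{γ+δ}⁺` on graded pieces, determined by
`[x] * [y] = [x y]`. -/
def mulPiece {γ δ : valueGroup v} : Piece v γ → Piece v δ → Piece v (γ + δ) :=
  Quotient.lift₂ (fun x y => cls v (γ + δ) (mulP x y)) (by
    intro x y x' y' hx hy
    exact cls_mulP_congr (Quotient.sound hx) (Quotient.sound hy))

theorem mulPiece_cls {γ δ : valueGroup v} (x : P v γ) (y : P v δ) :
    mulPiece (cls v γ x) (cls v δ y) = cls v (γ + δ) (mulP x y) := rfl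

theorem cls_add {γ : valueGroup v} (x y : P v γ) : cls v γ (x + y) = cls v γ x + cls v γ y := rfl

theorem cls_zero {γ : valueGroup v} : cls v γ 0 = 0 := rfl

theorem mk_cls_eq {γ δ : valueGroup v} (h : γ = δ) (x : P v γ) (y : P v δ)
    (hxy : (x : valRing v) = (y : valRing v)) :
    GradedMonoid.mk (A := Piece v) γ (cls v γ x) = GradedMonoid.mk δ (cls v δ y) := by
  subst h
  rw [Subtype.ext hxy]

/-- The element `1 ∈ P_0(V_ν)`. -/
def oneP : P v 0 := ⟨1, by rw [mem_P]; simp⟩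

instance instGOne : GradedMonoid.GOne (Piece v) := ⟨cls v 0 oneP⟩

instance instGMul : GradedMonoid.GMul (Piece v) := ⟨mulPiece⟩

instance instGCommRing : DirectSum.GCommRing (Piece v) where
  one := cls v 0 oneP
  mul := mulPiece
  mul_zero {γ δ} a := by
    obtain ⟨x, rfl⟩ := cls_surj a
    rw [← cls_zero, mulPiece_cls]
    exact congrArg _ (Subtype.ext (mul_zero _))
  zero_mul {γ δ} b := by
    obtain ⟨x, rfl⟩ := cls_surj b
    rw [← cls_zero, mulPiece_cls]
    exact congrArg _ (Subtype.ext (zero_mul _))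
  mul_add {γ δ} a b c := by
    obtain ⟨x, rfl⟩ := cls_surj a
    obtain ⟨y, rfl⟩ := cls_surj b
    obtain ⟨z, rfl⟩ := cls_surj c
    rw [← cls_add, mulPiece_cls, mulPiece_cls, mulPiece_cls, ← cls_add]
    exact congrArg _ (Subtype.ext (mul_add _ _ _))
  add_mul {γ δ} a b c := by
    obtain ⟨x, rfl⟩ := cls_surj a
    obtain ⟨y, rfl⟩ := cls_surj b
    obtain ⟨z, rfl⟩ := cls_surj c
    rw [← cls_add, mulPiece_cls, mulPiece_cls, mulPiece_cls, ← cls_add]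
    exact congrArg _ (Subtype.ext (add_mul _ _ _))
  one_mul := by
    rintro ⟨γ, a⟩
    obtain ⟨x, rfl⟩ := cls_surj a
    exact mk_cls_eq (zero_add γ) (mulP oneP x) x (one_mul _)
  mul_one := by
    rintro ⟨γ, a⟩
    obtain ⟨x, rfl⟩ := cls_surj a
    exact mk_cls_eq (add_zero γ) (mulP x oneP) x (mul_one _)
  mul_assoc := by
    rintro ⟨γ, a⟩ ⟨δ, b⟩ ⟨ε, c⟩
    obtain ⟨x, rfl⟩ := cls_surj a
    obtain ⟨y, rfl⟩ := cls_surj b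
    obtain ⟨z, rfl⟩ := cls_surj c
    exact mk_cls_eq (add_assoc γ δ ε) (mulP (mulP x y) z) (mulP x (mulP y z)) (mul_assoc _ _ _)
  mul_comm := by
    rintro ⟨γ, a⟩ ⟨δ, b⟩
    obtain ⟨x, rfl⟩ := cls_surj a
    obtain ⟨y, rfl⟩ := cls_surj b
    exact mk_cls_eq (add_comm γ δ) (mulP x y) (mulP y x) (mul_comm _ _)
  natCast n := n • cls v 0 oneP
  natCast_zero := zero_nsmul _
  natCast_succ n := succ_nsmul _ n
  intCast n := n • cls v 0 oneP
  intCast_ofNat n := natCast_zsmul _ n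
  intCast_negSucc_ofNat n := negSucc_zsmul _ n

variable (v) in
/-- The associated graded ring `gr_ν(V_ν) = ⨁_{γ ∈ Γ_ν} P_γ(V_ν) / P_γ⁺(V_ν)`. -/
abbrev Gr : Type _ := ⨁ γ : valueGroup v, Piece v γ

theorem mulPiece_ne_zero {γ δ : valueGroup v} {a : Piece v γ} {b : Piece v δ}
    (ha : a ≠ 0) (hb : b ≠ 0) : mulPiece a b ≠ 0 := by
  obtain ⟨x, rfl⟩ := cls_surj a
  obtain ⟨y, rfl⟩ := cls_surj b
  rw [mulPiece_cls]
  rw [Ne, cls_eq_zero_iff] at *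
  have hx := le_antisymm (not_lt.mp ha) x.2
  have hy := le_antisymm (not_lt.mp hb) y.2
  change ¬ _ < v ((x.1 : K) * (y.1 : K))
  rw [v.map_mul, hx, hy]
  simp

instance instIsDomainGr : IsDomain (Gr v) := by
  have : Nontrivial (Gr v) := by
    refine ⟨⟨1, 0, fun h => ?_⟩⟩
    have h' : (1 : Gr v) 0 = 0 := by rw [h]; rfl
    rw [DirectSum.one_def, DirectSum.of_eq_same] at h'
    have := (cls_eq_zero_iff (v := v) oneP).mp h'
    simp [oneP] at this
  have : NoZeroDivisors (Gr v) := by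
    classical
    refine ⟨fun {a b} hab => ?_⟩
    by_contra! h
    obtain ⟨ha, hb⟩ := h
    have hsa : (DFinsupp.support a).Nonempty := by
      rw [Finset.nonempty_iff_ne_empty]
      exact fun h => ha (DFinsupp.support_eq_empty.mp h)
    have hsb : (DFinsupp.support b).Nonempty := by
      rw [Finset.nonempty_iff_ne_empty]
      exact fun h => hb (DFinsupp.support_eq_empty.mp h)
    set i := (DFinsupp.support a).min' hsa
    set j := (DFinsupp.support b).min' hsb
    have hi : i ∈ DFinsupp.support a := Finset.min'_mem _ _
    have hj : j ∈ DFinsupp.support b := Finset.min'_mem _ _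
    have hne := mulPiece_ne_zero (DFinsupp.mem_support_iff.mp hi) (DFinsupp.mem_support_iff.mp hj)
    apply hne
    have h0 : (a * b) (i + j) = 0 := by rw [hab]; rfl
    rw [DirectSum.mul_eq_sum_support_ghas_mul, DFinsupp.finsetSum_apply,
      Finset.sum_eq_single (i, j)] at h0
    · rw [DirectSum.of_eq_same] at h0
      exact h0
    · rintro ⟨i', j'⟩ hmem hij
      rw [Finset.mem_product] at hmem
      apply DirectSum.of_eq_of_ne
      intro heq
      have h1 : i ≤ i' := Finset.min'_le _ _ hmem.1
      have h2 : j ≤ j' := Finset.min'_le _ _ hmem.2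
      have h3 : i' = i ∧ j' = j := by
        have := (add_eq_add_iff_eq_and_eq h1 h2).mp heq
        exact ⟨this.1.symm, this.2.symm⟩
      exact hij (Prod.ext h3.1 h3.2)
    · intro hnot
      exact absurd (Finset.mem_product.mpr ⟨hi, hj⟩) hnot
  exact NoZeroDivisors.to_isDomain _

variable (v) in
/-- The quotient field `QF(gr_ν(V_ν))`. -/
abbrev QFGr : Type _ := FractionRing (Gr v)

end Single

section Extension

variable (K : Type*) {L Γ : Type*} [Field K] [Field L] [Algebra K L]
  [AddCommGroup Γ] [LinearOrder Γ] [IsOrderedAddMonoid Γ]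

/-- The restriction `ν = ν*|K` of a valuation `ν*` of an extension field of `K`. -/
abbrev restr (w : AddValuation L (WithTop Γ)) : AddValuation K (WithTop Γ) :=
  w.comap (algebraMap K L)

variable (w : AddValuation L (WithTop Γ))

theorem valueGroup_restr_le : valueGroup (restr K w) ≤ valueGroup w := by
  rintro γ ⟨x, hx⟩
  exact ⟨algebraMap K L x, hx⟩

/-- The inclusion `Γ_ν → Γ_{ν*}`. -/
abbrev valueGroupIncl : valueGroup (restr K w) →+ valueGroup w :=
  AddSubgroup.inclusion (valueGroup_restr_le K w)

/-- The inclusion `V_ν → V_{ν*}`. -/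
def valRingMap : valRing (restr K w) →+* valRing w :=
  ((algebraMap K L).comp (valRing (restr K w)).subtype).codRestrict (valRing w) fun x => x.2

theorem coe_valRingMap (x : valRing (restr K w)) :
    ((valRingMap K w x : valRing w) : L) = algebraMap K L (x : K) := rfl

instance isLocalHom_valRingMap : IsLocalHom (valRingMap K w) := by
  refine ⟨fun x hx => ?_⟩
  obtain ⟨y, hy⟩ := hx.exists_right_inv
  have hxy : algebraMap K L (x : K) * (y : L) = 1 := congrArg Subtype.val hy
  have hx0 : (x : K) ≠ 0 := by
    intro h
    rw [h, map_zero, zero_mul] at hxy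
    exact zero_ne_one hxy
  have hinv : (x : K)⁻¹ ∈ valRing (restr K w) := by
    have : (y : L) = algebraMap K L (x : K)⁻¹ := by
      rw [map_inv₀]
      exact eq_inv_of_mul_eq_one_right hxy
    change 0 ≤ w (algebraMap K L (x : K)⁻¹)
    rw [← this]
    exact y.2
  exact IsUnit.of_mul_eq_one ⟨(x : K)⁻¹, hinv⟩ (Subtype.ext (mul_inv_cancel₀ hx0))

/-- The induced inclusion of residue fields `V_ν/m_ν → V_{ν*}/m_{ν*}`. -/
def residueMap : IsLocalRing.ResidueField (valRing (restr K w)) →+*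
    IsLocalRing.ResidueField (valRing w) :=
  IsLocalRing.ResidueField.map (valRingMap K w)

/-- The inclusion `P_γ(V_ν) → P_γ(V_{ν*})`, for `γ ∈ Γ_ν ⊆ Γ_{ν*}`. -/
def mapP (γ : valueGroup (restr K w)) (x : P (restr K w) γ) : P w (valueGroupIncl K w γ) :=
  ⟨valRingMap K w x.1, x.2⟩

/-- The map `P_γ(V_ν)/P_γ⁺(V_ν) → P_γ(V_{ν*})/P_γ⁺(V_{ν*})`, `[x] ↦ [x]`, for `γ ∈ Γ_ν`. -/
def pieceMap (γ : valueGroup (restr K w)) :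
    Piece (restr K w) γ →+ Piece w (valueGroupIncl K w γ) where
  toFun := Quotient.lift (fun x => cls w _ (mapP K w γ x)) (by
    intro x y hxy
    have h := (cls_eq_iff (v := restr K w) x y).mp (Quotient.sound hxy)
    rw [cls_eq_iff]
    change _ < w (algebraMap K L ((x.1 : K) - (y.1 : K))) at h
    rw [map_sub] at h
    exact h)
  map_zero' := congrArg (cls w _) (Subtype.ext (map_zero (valRingMap K w)))
  map_add' := by
    intro a b
    obtain ⟨x, rfl⟩ := cls_surj a
    obtain ⟨y, rfl⟩ := cls_surj b
    exact congrArg (cls w _) (Subtype.ext (map_add (valRingMap K w) x.1 y.1))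

theorem pieceMap_cls (γ : valueGroup (restr K w)) (x : P (restr K w) γ) :
    pieceMap K w γ (cls (restr K w) γ x) = cls w _ (mapP K w γ x) := rfl

theorem pieceMap_injective (γ : valueGroup (restr K w)) :
    Function.Injective (pieceMap K w γ) := by
  rw [injective_iff_map_eq_zero]
  intro a ha
  obtain ⟨x, rfl⟩ := cls_surj a
  rw [pieceMap_cls, cls_eq_zero_iff] at ha
  rw [cls_eq_zero_iff]
  exact ha

/-- The natural graded ring homomorphism `gr_ν(V_ν) → gr_{ν*}(V_{ν*})`. -/
def grMap : Gr (restr K w) →+* Gr w :=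
  DirectSum.toSemiring
    (fun γ => (DirectSum.of (Piece w) (valueGroupIncl K w γ)).comp (pieceMap K w γ))
    (by
      change DirectSum.of (Piece w) _ (pieceMap K w 0 (cls (restr K w) 0 oneP)) = _
      rw [DirectSum.one_def]
      apply DirectSum.of_eq_of_gradedMonoid_eq
      exact mk_cls_eq (map_zero _) (mapP K w 0 oneP) oneP (map_one (valRingMap K w)))
    (by
      intro γ δ a b
      obtain ⟨x, rfl⟩ := cls_surj a
      obtain ⟨y, rfl⟩ := cls_surj b
      simp only [AddMonoidHom.comp_apply]
      rw [DirectSum.of_mul_of]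
      apply DirectSum.of_eq_of_gradedMonoid_eq
      exact mk_cls_eq (map_add _ γ δ) (mapP K w (γ + δ) (mulP x y))
        (mulP (mapP K w γ x) (mapP K w δ y)) (map_mul (valRingMap K w) x.1 y.1))

theorem grMap_of (γ : valueGroup (restr K w)) (a : Piece (restr K w) γ) :
    grMap K w (DirectSum.of (Piece (restr K w)) γ a) =
      DirectSum.of (Piece w) (valueGroupIncl K w γ) (pieceMap K w γ a) :=
  DirectSum.toSemiring_of _ _ _ _ _

theorem grMap_apply (x : Gr (restr K w)) (γ : valueGroup (restr K w)) :
    grMap K w x (valueGroupIncl K w γ) = pieceMap K w γ (x γ) := by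
  induction x using DirectSum.induction_on with
  | zero => rw [map_zero, DirectSum.zero_apply, DirectSum.zero_apply, map_zero]
  | of δ a =>
    rw [grMap_of]
    by_cases h : δ = γ
    · subst h
      rw [DirectSum.of_eq_same, DirectSum.of_eq_same]
    · rw [DirectSum.of_eq_of_ne _ _ _ (Ne.symm h), map_zero]
      apply DirectSum.of_eq_of_ne
      exact fun e => h (AddSubgroup.inclusion_injective (valueGroup_restr_le K w) e).symm
  | add a b ha hb => rw [map_add, DirectSum.add_apply, DirectSum.add_apply, map_add, ha, hb]

theorem grMap_injective : Function.Injective (grMap K w) := by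
  rw [injective_iff_map_eq_zero]
  intro x hx
  refine DFinsupp.ext fun γ => ?_
  apply pieceMap_injective K w γ
  have h := grMap_apply K w x γ
  rw [hx] at h
  exact h.symm.trans (map_zero _).symm

/-- `QF(gr_{ν*}(V_{ν*}))` as an extension field of `QF(gr_ν(V_ν))`, through the field homomorphism
induced by the injection `gr_ν(V_ν) → gr_{ν*}(V_{ν*})`. -/
instance instAlgebraQFGr : Algebra (QFGr (restr K w)) (QFGr w) :=
  (IsFractionRing.map (K := QFGr (restr K w)) (L := QFGr w) (grMap_injective K w)).toAlgebra

/-- The quotient group `Γ_{ν*}/Γ_ν`. -/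
abbrev ValueGroupQuotient : Type _ :=
  valueGroup w ⧸ (valueGroup (restr K w)).addSubgroupOf (valueGroup w)

end Extension

end GrVal

end

noncomputable section

namespace GrVal

open scoped DirectSum

/-! ### Characters of the value group acting on the graded ring -/

section Twist

variable {K Γ : Type*} [Field K] [AddCommGroup Γ] [LinearOrder Γ] [IsOrderedAddMonoid Γ]
  {v : AddValuation K (WithTop Γ)}

/-! This is Kummer theory for graded rings. Write `k` for the residue field and `G` for
`Γ_{ν*}/Γ_ν`. The degree-zero piece of `gr_{ν*}` is `k`, so a character `χ : G → kˣ` acts on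
`gr_{ν*}` by multiplying degree `γ` by `χ(γ)`. This action is faithful, because every nonnegative
degree has a nonzero piece and these degrees generate `Γ_{ν*}` (`eq_one_of_forall_twist_eq`).

An element is invariant only if all characters of `G` are trivial on the degrees in its support. Now
`G` is finite (`finite_valueGroupQuotient`) and `k` contains enough roots of unity, so characters
separate the points of `G` and those degrees lie in `Γ_ν`. In such degrees, equality of residue
fields makes the pieces of `gr_ν` and `gr_{ν*}` agree (`pieceMap_surjective`), so the ring of
invariants is exactly `gr_ν`.

Passing to quotient fields gives a finite Galois extension whose group is the dual of `G`, and a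
finite abelian group is isomorphic to its dual. -/

theorem mem_maximalIdeal_iff (x : valRing v) :
    x ∈ IsLocalRing.maximalIdeal (valRing v) ↔ 0 < v (x : K) := by
  rw [IsLocalRing.mem_maximalIdeal, mem_nonunits_iff, ← not_iff_not, not_not, not_lt]
  constructor
  · intro hx
    obtain ⟨y, hy⟩ := hx.exists_right_inv
    have h : v (x : K) + v (y : K) = 0 := by
      rw [← v.map_mul, show (x : K) * (y : K) = 1 from congrArg Subtype.val hy, v.map_one]
    rw [← h]
    exact le_add_of_nonneg_right y.2
  · intro hx
    have h0 : v (x : K) = 0 := le_antisymm hx x.2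
    have hx0 : (x : K) ≠ 0 := by
      intro h
      rw [h, v.map_zero] at h0
      exact WithTop.top_ne_zero h0
    have hinv : (x : K)⁻¹ ∈ valRing v := by
      rw [mem_valRing, v.map_inv, h0]
      exact neg_zero.ge
    exact IsUnit.of_mul_eq_one ⟨(x : K)⁻¹, hinv⟩ (Subtype.ext (mul_inv_cancel₀ hx0))

/-- An element of the valuation ring, viewed in `P_0(V_ν) = V_ν`. -/
def toPZero (x : valRing v) : P v 0 := ⟨x, x.2⟩

variable (v) in
/-- The ring homomorphism `V_ν → gr_ν(V_ν)` onto the piece of degree zero. -/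
def degreeZeroHom : valRing v →+* Gr v where
  toFun x := DirectSum.of (Piece v) 0 (cls v 0 (toPZero x))
  map_one' := rfl
  map_zero' := map_zero (DirectSum.of (Piece v) 0)
  map_add' x y := map_add (DirectSum.of (Piece v) 0) (cls v 0 (toPZero x)) (cls v 0 (toPZero y))
  map_mul' x y := by
    rw [DirectSum.of_mul_of]
    apply DirectSum.of_eq_of_gradedMonoid_eq
    exact mk_cls_eq (add_zero 0).symm (toPZero (x * y)) (mulP (toPZero x) (toPZero y)) rfl

variable (v) in
/-- The residue field as the piece of degree zero of `gr_ν(V_ν)`. -/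
def residueHom : IsLocalRing.ResidueField (valRing v) →+* Gr v :=
  Ideal.Quotient.lift _ (degreeZeroHom v) fun x hx => by
    have : cls v 0 (toPZero x) = 0 := (cls_eq_zero_iff _).mpr ((mem_maximalIdeal_iff x).mp hx)
    change DirectSum.of (Piece v) 0 (cls v 0 (toPZero x)) = 0
    rw [this, map_zero]

theorem residueHom_residue (x : valRing v) :
    residueHom v (IsLocalRing.residue _ x) = DirectSum.of (Piece v) 0 (cls v 0 (toPZero x)) := rfl

/-- Scalars have degree zero, so multiplying by one preserves homogeneity. This is what allows
components of a twisted element to be read off. -/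
theorem exists_residueHom_mul_of (c : IsLocalRing.ResidueField (valRing v)) (γ : valueGroup v)
    (a : Piece v γ) :
    ∃ b : Piece v γ, residueHom v c * DirectSum.of (Piece v) γ a = DirectSum.of (Piece v) γ b := by
  obtain ⟨x, rfl⟩ := IsLocalRing.residue_surjective c
  obtain ⟨y, rfl⟩ := cls_surj a
  refine ⟨cls v γ ⟨x * y.1, (P v γ).mul_mem_left x y.2⟩, ?_⟩
  rw [residueHom_residue, DirectSum.of_mul_of]
  apply DirectSum.of_eq_of_gradedMonoid_eq
  exact mk_cls_eq (zero_add γ) (mulP (toPZero x) y) _ rfl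

variable (v) in
/-- The characters of the value group with values in the residue field. -/
abbrev ResidueChar : Type _ :=
  Multiplicative (valueGroup v) →* (IsLocalRing.ResidueField (valRing v))ˣ

/-- The value in `gr_ν(V_ν)` of a character of the value group. -/
def charValue (χ : ResidueChar v) (γ : valueGroup v) : Gr v :=
  residueHom v (χ (Multiplicative.ofAdd γ) : (IsLocalRing.ResidueField (valRing v))ˣ)

theorem charValue_zero (χ : ResidueChar v) : charValue χ 0 = 1 := by
  simp [charValue]

theorem charValue_add (χ : ResidueChar v) (γ δ : valueGroup v) :
    charValue χ (γ + δ) = charValue χ γ * charValue χ δ := by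
  simp [charValue]

theorem charValue_one (γ : valueGroup v) : charValue (1 : ResidueChar v) γ = 1 := by
  simp [charValue]

theorem charValue_mul (χ ψ : ResidueChar v) (γ : valueGroup v) :
    charValue (χ * ψ) γ = charValue χ γ * charValue ψ γ := by
  simp [charValue]

theorem charValue_eq_one_iff (χ : ResidueChar v) (γ : valueGroup v) :
    charValue χ γ = 1 ↔ χ (Multiplicative.ofAdd γ) = 1 := by
  rw [charValue, map_eq_one_iff _ (residueHom v).injective, Units.val_eq_one]

/-- The graded endomorphism of `gr_ν(V_ν)` multiplying the piece of degree `γ` by `χ(γ)`. -/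
def twist (χ : ResidueChar v) : Gr v →+* Gr v :=
  DirectSum.toSemiring
    (fun γ => (AddMonoidHom.mulLeft (charValue χ γ)).comp (DirectSum.of (Piece v) γ))
    (by
      change charValue χ 0 * DirectSum.of (Piece v) 0 GradedMonoid.GOne.one = 1
      rw [charValue_zero, one_mul, DirectSum.one_def])
    (by
      intro γ δ a b
      simp only [AddMonoidHom.comp_apply, AddMonoidHom.coe_mulLeft]
      rw [charValue_add, ← DirectSum.of_mul_of, mul_mul_mul_comm])

theorem twist_of (χ : ResidueChar v) (γ : valueGroup v) (a : Piece v γ) :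
    twist χ (DirectSum.of (Piece v) γ a) = charValue χ γ * DirectSum.of (Piece v) γ a :=
  DirectSum.toSemiring_of _ _ _ _ _

/-- Scalars sit in degree zero, where `χ` is `1`. Twists are thus linear over the residue field,
which is why composing them multiplies the characters. -/
theorem twist_residueHom (χ : ResidueChar v) (c : IsLocalRing.ResidueField (valRing v)) :
    twist χ (residueHom v c) = residueHom v c := by
  obtain ⟨x, rfl⟩ := IsLocalRing.residue_surjective c
  rw [residueHom_residue, twist_of, charValue_zero, one_mul]

theorem twist_one (x : Gr v) : twist 1 x = x := by
  induction x using DirectSum.induction_on with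
  | zero => exact map_zero _
  | of γ a => rw [twist_of, charValue_one, one_mul]
  | add a b ha hb => rw [map_add, ha, hb]

theorem twist_mul (χ ψ : ResidueChar v) (x : Gr v) : twist (χ * ψ) x = twist χ (twist ψ x) := by
  induction x using DirectSum.induction_on with
  | zero => simp only [map_zero]
  | of γ a =>
    rw [twist_of, twist_of, map_mul, twist_of, charValue_mul]
    rw [show twist χ (charValue ψ γ) = charValue ψ γ from twist_residueHom χ _]
    ring
  | add a b ha hb => simp only [map_add, ha, hb]

theorem of_twist_apply (χ : ResidueChar v) (x : Gr v) (γ : valueGroup v) :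
    DirectSum.of (Piece v) γ (twist χ x γ) =
      charValue χ γ * DirectSum.of (Piece v) γ (x γ) := by
  induction x using DirectSum.induction_on with
  | zero => rw [map_zero, DirectSum.zero_apply, map_zero, mul_zero]
  | of δ a =>
    obtain ⟨b, hb⟩ := exists_residueHom_mul_of
      (χ (Multiplicative.ofAdd δ) : (IsLocalRing.ResidueField (valRing v))ˣ) δ a
    change charValue χ δ * _ = _ at hb
    rw [twist_of, hb]
    by_cases h : δ = γ
    · subst h
      rw [DirectSum.of_eq_same, DirectSum.of_eq_same, hb]
    · rw [DirectSum.of_eq_of_ne _ _ _ (Ne.symm h), DirectSum.of_eq_of_ne _ _ _ (Ne.symm h),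
        map_zero, mul_zero]
  | add a b ha hb =>
    rw [map_add, DirectSum.add_apply, DirectSum.add_apply, map_add, map_add, ha, hb, mul_add]

/-- The action of the characters of the value group on `gr_ν(V_ν)` by twisting. -/
instance instMulSemiringActionResidueChar : MulSemiringAction (ResidueChar v) (Gr v) where
  smul χ x := twist χ x
  one_smul := twist_one
  mul_smul := twist_mul
  smul_zero χ := map_zero (twist χ)
  smul_add χ := map_add (twist χ)
  smul_one χ := map_one (twist χ)
  smul_mul χ := map_mul (twist χ)

/-- Compare components of degree `γ` and cancel the nonzero one in the domain `Gr v`. Both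
faithfulness and the computation of invariants rest on this. -/
theorem apply_eq_one_of_twist_eq {χ : ResidueChar v} {x : Gr v} (h : twist χ x = x)
    {γ : valueGroup v} (hγ : x γ ≠ 0) : χ (Multiplicative.ofAdd γ) = 1 := by
  have h1 := of_twist_apply χ x γ
  rw [h] at h1
  have h2 : DirectSum.of (Piece v) γ (x γ) ≠ 0 := by
    rwa [Ne, map_eq_zero_iff _ (DirectSum.of_injective γ)]
  exact (charValue_eq_one_iff χ γ).mp (mul_right_cancel₀ h2 (by rw [one_mul, ← h1]))

/-- The sign condition is essential: the graded ring is that of the valuation ring, so its pieces of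
negative degree vanish. -/
theorem exists_piece_ne_zero {γ : valueGroup v} (hγ : 0 ≤ γ) : ∃ a : Piece v γ, a ≠ 0 := by
  obtain ⟨x, hx⟩ := γ.2
  have h0 : 0 ≤ v x := by
    rw [hx]
    exact_mod_cast hγ
  refine ⟨cls v γ ⟨⟨x, h0⟩, hx.ge⟩, ?_⟩
  rw [Ne, cls_eq_zero_iff]
  exact hx.le.not_gt

theorem eq_one_of_forall_twist_eq {χ : ResidueChar v} (h : ∀ x, twist χ x = x) : χ = 1 := by
  have key : ∀ γ : valueGroup v, 0 ≤ γ → χ (Multiplicative.ofAdd γ) = 1 := by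
    intro γ hγ
    obtain ⟨a, ha⟩ := exists_piece_ne_zero hγ
    refine apply_eq_one_of_twist_eq (h (DirectSum.of (Piece v) γ a)) ?_
    rwa [DirectSum.of_eq_same]
  refine MonoidHom.ext fun γ => ?_
  -- The nonnegative degrees generate the group: a negative `γ` is handled through `-γ`.
  rcases le_total 0 γ.toAdd with hγ | hγ
  · exact key _ hγ
  · have := key (-γ.toAdd) (neg_nonneg.mpr hγ)
    rw [ofAdd_neg, map_inv, inv_eq_one] at this
    exact this

end Twist

/-! ### Finiteness of the quotient, comparison of pieces, and invariants -/

section Extension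

variable (K : Type*) {L Γ : Type*} [Field K] [Field L] [Algebra K L]
  [AddCommGroup Γ] [LinearOrder Γ] [IsOrderedAddMonoid Γ] (w : AddValuation L (WithTop Γ))

variable {K w} in
/-- Elements whose values lie in distinct cosets of `Γ_ν` are linearly independent over `K`. -/
theorem linearIndependent_of_injective_cosets {ι : Type*} (x : ι → L) (γ : ι → valueGroup w)
    (hx : ∀ i, w (x i) = ((γ i : Γ) : WithTop Γ))
    (hγ : Function.Injective fun i => (γ i : ValueGroupQuotient K w)) :
    LinearIndependent K x := by
  classical
  rw [linearIndependent_iff']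
  intro s g hsum
  by_contra! hne
  obtain ⟨i₀, hi₀, hgi₀⟩ := hne
  set t := s.filter fun i => g i ≠ 0
  have hval : ∀ i ∈ t, ∃ δ : valueGroup (restr K w), w (g i • x i) =
      ((((valueGroupIncl K w δ + γ i : valueGroup w)) : Γ) : WithTop Γ) := by
    intro i hi
    have hgi : algebraMap K L (g i) ≠ 0 :=
      (map_ne_zero _).mpr (Finset.mem_filter.mp hi).2
    obtain ⟨δ, hδ⟩ := WithTop.ne_top_iff_exists.mp (w.ne_top_iff.mpr hgi)
    refine ⟨⟨δ, g i, hδ.symm⟩, ?_⟩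
    rw [Algebra.smul_def, w.map_mul, hx]
    exact congrArg (· + ((γ i : Γ) : WithTop Γ)) hδ.symm
  -- Scaling by a nonzero element of `K` does not change the coset of the value, so the nonzero
  -- terms have pairwise distinct values.
  have hinj : ∀ i ∈ t, ∀ j ∈ t, w (g i • x i) = w (g j • x j) → i = j := by
    intro i hi j hj hij
    obtain ⟨δ, hδ⟩ := hval i hi
    obtain ⟨ε, hε⟩ := hval j hj
    rw [hδ, hε] at hij
    have hij' : valueGroupIncl K w δ + γ i = valueGroupIncl K w ε + γ j :=
      Subtype.ext (WithTop.coe_injective hij)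
    apply hγ
    change (γ i : ValueGroupQuotient K w) = γ j
    rw [QuotientAddGroup.eq, AddSubgroup.mem_addSubgroupOf]
    have h : -γ i + γ j = valueGroupIncl K w (δ - ε) := by
      rw [map_sub, eq_sub_iff_add_eq, add_assoc, add_comm (γ j), ← hij']
      abel
    rw [h]
    exact (δ - ε).2
  obtain ⟨j, hj, hmin⟩ := t.exists_min_image (fun i => w (g i • x i))
    ⟨i₀, Finset.mem_filter.mpr ⟨hi₀, hgi₀⟩⟩
  have hsum' : ∑ i ∈ t, g i • x i = 0 := by
    rw [← hsum]
    refine Finset.sum_subset (Finset.filter_subset _ _) fun i hi hit => ?_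
    have : g i = 0 := by
      by_contra h
      exact hit (Finset.mem_filter.mpr ⟨hi, h⟩)
    rw [this, zero_smul]
  rw [← Finset.add_sum_erase t _ hj] at hsum'
  obtain ⟨δ, hδ⟩ := hval j hj
  -- The unique term of least value cannot be cancelled by the others, although the relation makes
  -- it the negative of their sum.
  have hlt : w (g j • x j) < w (∑ i ∈ t.erase j, g i • x i) := by
    refine w.map_lt_sum (by rw [hδ]; exact WithTop.coe_ne_top) fun i hi => ?_
    have hit := Finset.mem_of_mem_erase hi
    exact lt_of_le_of_ne (hmin i hit) fun h => Finset.ne_of_mem_erase hi (hinj j hj i hit h).symm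
  rw [eq_neg_of_add_eq_zero_left hsum', w.map_neg] at hlt
  exact lt_irrefl _ hlt

/-- One element of `L` with value in each coset gives a family independent over `K`, so there are at
most `[L : K]` cosets. -/
instance finite_valueGroupQuotient [FiniteDimensional K L] : Finite (ValueGroupQuotient K w) := by
  choose x hx using fun q : ValueGroupQuotient K w => (Quotient.out q : valueGroup w).2
  have : LinearIndependent K x :=
    linearIndependent_of_injective_cosets x (fun q => Quotient.out q) hx fun p q hpq => by
      simpa using hpq
  exact this.finite_of_isNoetherian

variable {w} in
theorem piece_eq_zero_of_neg {γ : valueGroup w} (hγ : γ < 0) (a : Piece w γ) : a = 0 := by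
  obtain ⟨x, rfl⟩ := cls_surj a
  rw [cls_eq_zero_iff]
  refine lt_of_lt_of_le ?_ x.1.2
  exact_mod_cast hγ

variable {K w} in
-- Given `y` representing a class of degree `γ ≥ 0`, take `t` in `K` of value `γ`. Then `y / t` is
-- integral, and its residue lifts to some `u` in `V_ν`; the element `u * t` of `K` has the same
-- class as `y`.
theorem pieceMap_surjective (hres : Function.Surjective (residueMap K w))
    (γ : valueGroup (restr K w)) : Function.Surjective (pieceMap K w γ) := by
  intro a
  rcases lt_or_ge γ 0 with hγ | hγ
  · exact ⟨0, by rw [map_zero, piece_eq_zero_of_neg (show valueGroupIncl K w γ < 0 from hγ) a]⟩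
  obtain ⟨y, rfl⟩ := cls_surj a
  obtain ⟨t, ht⟩ := γ.2
  change w (algebraMap K L t) = _ at ht
  have ht0 : algebraMap K L t ≠ 0 := by
    rw [← w.ne_top_iff, ht]
    exact WithTop.coe_ne_top
  have hmul : ∀ z : L, w (z * algebraMap K L t) = w z + ((γ : Γ) : WithTop Γ) := fun z => by
    rw [w.map_mul, ht]
  have hy : ((γ : Γ) : WithTop Γ) ≤ w (y.1 : L) := y.2
  have hz : 0 ≤ w ((y.1 : L) / algebraMap K L t) := by
    have h := hmul ((y.1 : L) / algebraMap K L t)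
    rw [div_mul_cancel₀ _ ht0] at h
    rw [h] at hy
    exact (WithTop.add_le_add_iff_right (z := ((γ : Γ) : WithTop Γ)) WithTop.coe_ne_top).mp
      (by rwa [zero_add])
  obtain ⟨c, hc⟩ := hres (IsLocalRing.residue _ (⟨_, hz⟩ : valRing w))
  obtain ⟨u, rfl⟩ := IsLocalRing.residue_surjective c
  have hu : 0 < w ((algebraMap K L (u : K)) - (y.1 : L) / algebraMap K L t) := by
    have h : IsLocalRing.residue (valRing w) (valRingMap K w u) =
        IsLocalRing.residue _ (⟨_, hz⟩ : valRing w) := hc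
    have h' := (mem_maximalIdeal_iff _).mp (Ideal.Quotient.eq.mp h)
    exact h'
  have hdiff : ((γ : Γ) : WithTop Γ) <
      w (algebraMap K L ((u : K) * t) - (y.1 : L)) := by
    have h : algebraMap K L ((u : K) * t) - (y.1 : L) =
        (algebraMap K L (u : K) - (y.1 : L) / algebraMap K L t) * algebraMap K L t := by
      rw [sub_mul, div_mul_cancel₀ _ ht0, map_mul]
    rw [h, hmul]
    have := WithTop.add_lt_add_right (z := ((γ : Γ) : WithTop Γ)) WithTop.coe_ne_top hu
    rwa [zero_add] at this
  have hut : ((γ : Γ) : WithTop Γ) ≤ w (algebraMap K L ((u : K) * t)) := by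
    rw [map_mul, hmul]
    exact le_add_of_nonneg_left u.2
  have hut0 : 0 ≤ restr K w ((u : K) * t) :=
    le_trans (by exact_mod_cast hγ) hut
  refine ⟨cls (restr K w) γ ⟨⟨(u : K) * t, hut0⟩, hut⟩, ?_⟩
  rw [pieceMap_cls, cls_eq_iff]
  exact hdiff

/-- The characters of `Γ_{ν*}/Γ_ν` with values in the residue field of `ν*`. -/
abbrev QuotientChar : Type _ :=
  Multiplicative (ValueGroupQuotient K w) →* (IsLocalRing.ResidueField (valRing w))ˣ

/-- The inflation of a character of `Γ_{ν*}/Γ_ν` to `Γ_{ν*}`. -/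
def inflate : QuotientChar K w →* ResidueChar w :=
  MonoidHom.compHom' (AddMonoidHom.toMultiplicative (QuotientAddGroup.mk' _))

theorem inflate_apply (χ : QuotientChar K w) (γ : valueGroup w) :
    inflate K w χ (Multiplicative.ofAdd γ) =
      χ (Multiplicative.ofAdd (γ : ValueGroupQuotient K w)) := rfl

theorem inflate_injective : Function.Injective (inflate K w) := by
  intro χ ψ h
  refine MonoidHom.ext fun q => ?_
  obtain ⟨γ, hγ⟩ := QuotientAddGroup.mk_surjective q.toAdd
  have := DFunLike.congr_fun h (Multiplicative.ofAdd γ)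
  rw [inflate_apply, inflate_apply, hγ] at this
  exact this

instance instMulSemiringActionQuotientChar : MulSemiringAction (QuotientChar K w) (Gr w) :=
  MulSemiringAction.compHom (Gr w) (inflate K w)

theorem quotientChar_smul (χ : QuotientChar K w) (x : Gr w) :
    χ • x = twist (inflate K w χ) x := rfl

/-- `gr_{ν*}(V_{ν*})` as an algebra over `gr_ν(V_ν)`. -/
instance instAlgebraGr : Algebra (Gr (restr K w)) (Gr w) := (grMap K w).toAlgebra

/-- This compatibility is needed to carry the Galois group from the graded rings to their quotient
fields. -/
instance isScalarTower_gr_qfGr : IsScalarTower (Gr (restr K w)) (QFGr (restr K w)) (QFGr w) :=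
  IsScalarTower.of_algebraMap_eq' <| by
    rw [IsScalarTower.algebraMap_eq (Gr (restr K w)) (Gr w) (QFGr w)]
    exact (IsLocalization.map_comp (S := QFGr (restr K w)) (Q := QFGr w) (g := grMap K w)
      (nonZeroDivisors_le_comap_nonZeroDivisors_of_injective _ (grMap_injective K w))).symm

instance faithfulSMul_qfGr : FaithfulSMul (QFGr (restr K w)) (QFGr w) :=
  (faithfulSMul_iff_algebraMap_injective _ _).mpr (algebraMap (QFGr (restr K w)) (QFGr w)).injective

/-- The image of `gr_ν` lives in degrees from `Γ_ν`, where inflated characters are trivial. -/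
theorem twist_inflate_grMap (χ : QuotientChar K w) (x : Gr (restr K w)) :
    twist (inflate K w χ) (grMap K w x) = grMap K w x := by
  induction x using DirectSum.induction_on with
  | zero => simp only [map_zero]
  | of γ a =>
    rw [grMap_of, twist_of, (charValue_eq_one_iff _ _).mpr, one_mul]
    have : (valueGroupIncl K w γ : ValueGroupQuotient K w) = 0 := by
      rw [QuotientAddGroup.eq_zero_iff, AddSubgroup.mem_addSubgroupOf]
      exact γ.2
    rw [inflate_apply, this, ofAdd_zero, map_one]
  | add a b ha hb => simp only [map_add, ha, hb]

variable {K w} in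
theorem mem_range_grMap (hres : Function.Surjective (residueMap K w)) {x : Gr w}
    (hx : ∀ γ, x γ ≠ 0 → (γ : Γ) ∈ valueGroup (restr K w)) : x ∈ (grMap K w).range := by
  classical
  rw [← DirectSum.sum_support_of x]
  refine sum_mem fun γ hγ => ?_
  obtain ⟨b, hb⟩ := pieceMap_surjective hres ⟨γ, hx γ (DFinsupp.mem_support_iff.mp hγ)⟩ (x γ)
  refine ⟨DirectSum.of _ _ b, ?_⟩
  rw [grMap_of, hb]
  rfl

variable {K w} in
/-- The character group of `Γ_{ν*}/Γ_ν` is a Galois group of `gr_{ν*}(V_{ν*})` over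
`gr_ν(V_ν)`. -/
theorem isGaloisGroup_quotientChar [Finite (ValueGroupQuotient K w)]
    (hres : Function.Surjective (residueMap K w))
    [HasEnoughRootsOfUnity (IsLocalRing.ResidueField (valRing w))
      (Monoid.exponent (Multiplicative (ValueGroupQuotient K w)))] :
    IsGaloisGroup (QuotientChar K w) (Gr (restr K w)) (Gr w) where
  faithful := by
    refine ⟨fun {χ ψ} h => ?_⟩
    rw [← inv_mul_eq_one]
    apply inflate_injective K w
    rw [map_one]
    refine eq_one_of_forall_twist_eq fun x => ?_
    rw [← quotientChar_smul, mul_smul, ← h, inv_smul_smul]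
  commutes := by
    refine ⟨fun χ a x => ?_⟩
    rw [Algebra.smul_def, Algebra.smul_def, smul_mul']
    congr 1
    exact twist_inflate_grMap K w χ a
  isInvariant := by
    refine ⟨fun x hx => mem_range_grMap hres fun γ hγ => ?_⟩
    have h : Multiplicative.ofAdd (γ : ValueGroupQuotient K w) = 1 := by
      by_contra hne
      -- Duality for finite abelian groups: a degree outside `Γ_ν` would be detected by some
      -- character, contradicting invariance.
      obtain ⟨χ, hχ⟩ := CommGroup.exists_apply_ne_one_of_hasEnoughRootsOfUnity _
        (IsLocalRing.ResidueField (valRing w)) hne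
      exact hχ (apply_eq_one_of_twist_eq (hx χ) hγ)
    rw [ofAdd_eq_one, QuotientAddGroup.eq_zero_iff, AddSubgroup.mem_addSubgroupOf] at h
    exact h

end Extension

end GrVal

end

theorem mainTheorem4 {K L Γ : Type*} [Field K] [Field L] [Algebra K L] [FiniteDimensional K L]
    [AddCommGroup Γ] [LinearOrder Γ] [IsOrderedAddMonoid Γ]
    (w : AddValuation L (WithTop Γ))
    (hres : Function.Bijective (GrVal.residueMap K w))
    (hclosed : IsAlgClosed (IsLocalRing.ResidueField (GrVal.valRing w)))
    (hchar : CharZero (IsLocalRing.ResidueField (GrVal.valRing w))) :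
    FiniteDimensional (GrVal.QFGr (GrVal.restr K w)) (GrVal.QFGr w) ∧
    IsGalois (GrVal.QFGr (GrVal.restr K w)) (GrVal.QFGr w) ∧
    Nonempty (Gal(GrVal.QFGr w/GrVal.QFGr (GrVal.restr K w)) ≃*
      Multiplicative (GrVal.ValueGroupQuotient K w)) := by
  -- The exponent of the finite quotient is nonzero, hence nonzero in characteristic zero; algebraic
  -- closedness then supplies enough roots of unity.
  have : NeZero ((Monoid.exponent (Multiplicative (GrVal.ValueGroupQuotient K w)) : ℕ) :
      IsLocalRing.ResidueField (GrVal.valRing w)) :=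
    ⟨Nat.cast_ne_zero.mpr (NeZero.ne _)⟩
  have := GrVal.isGaloisGroup_quotientChar hres.surjective
  let := IsFractionRing.mulSemiringAction (GrVal.QuotientChar K w) (GrVal.Gr w) (GrVal.QFGr w)
  have : IsGaloisGroup (GrVal.QuotientChar K w) (GrVal.QFGr (GrVal.restr K w)) (GrVal.QFGr w) :=
    IsGaloisGroup.to_isFractionRing _ (GrVal.Gr (GrVal.restr K w)) (GrVal.Gr w) _ _
  -- The Galois group is canonically the dual of the quotient; identifying the dual with the
  -- quotient itself is a choice.
  obtain ⟨e⟩ := CommGroup.monoidHom_mulEquiv_of_hasEnoughRootsOfUnity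
    (Multiplicative (GrVal.ValueGroupQuotient K w)) (IsLocalRing.ResidueField (GrVal.valRing w))
  exact ⟨IsGaloisGroup.finiteDimensional (GrVal.QuotientChar K w) _ _,
    IsGaloisGroup.isGalois (GrVal.QuotientChar K w) _ _,
    ⟨(IsGaloisGroup.mulEquivAlgEquiv (GrVal.QuotientChar K w) _ _).symm.trans e⟩⟩
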